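/- Work in $\mathrm{ZF}^-$, i.e. Zermelo–Fraenkel set theory (Extensionality, Pairing, Union, Power Set, Infinity, and the Separation and Replacement schemas) without the Axiom of Regularity; the Axiom of Choice is not assumed. For a set $x$ consider the following game of two players I and II: first I chooses $x_0\in x$, then II chooses $x_1\in x_0$, then I chooses $x_2\in x_1$, and so on; a player wins if the adversary cannot make any next move (i.e. if the player has chosen the empty set), and nobody wins an infinite play. A set $x$ is called \emph{winning} if one of the players has a winning strategy in the game on $x$. As choice is not available, strategies may be non-deterministic: a strategy of a player assigns to each history of play that is reached according to it and at which this player is to move a nonempty set of allowed legal moves, while all legal moves of the adversary are taken into account; it is winning if the tree of finite plays according to it is well-founded (every nonempty set of such plays contains one that has no one-move extension in the set). Let $W$ be the class of winning sets, and let $$HW=\{x:\mathrm{tc}(\{x\})\subseteq W\}$$ be the class of hereditarily winning sets, where $\mathrm{tc}(a)$ is the transitive closure of $a$, the least transitive set that includes $a$. Let $V_\infty$ be the class of well-founded sets, i.e. of those $x$ for which every nonempty subset of $\mathrm{tc}(\{x\})$ has an $\in$-minimal element. \textbf{Theorem 1.} $HW$ is an inner model of $\mathrm{ZF}^-$, i.e.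 a transitive class that contains all ordinals and satisfies every axiom of $\mathrm{ZF}^-$. Moreover, $HW\supseteq V_\infty$. (In model-theoretic form: in every model $(M,E)$ of $\mathrm{ZF}^-$, with all the notions above interpreted inside $(M,E)$, $HW$ is a definable transitive class that contains all ordinals of $(M,E)$ and whose elements with the restricted relation $E$ form a model of $\mathrm{ZF}^-$; and $HW\supseteq V_\infty$.) -/

import Mathlib

universe u

namespace SetGame

/-- The only non-logical symbol of the language of set theory: a binary relation symbol. -/
inductive SetRel : ℕ → Type
  | mem : SetRel 2

/-- The first-order language of set theory. -/
def setLang : FirstOrder.Language := ⟨fun _ => Empty, SetRel⟩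

/-- A binary relation `E` on `M` ("membership") as a structure for the language of set theory. -/
@[reducible]
def setStructure {M : Type u} (E : M → M → Prop) : setLang.Structure M where
  funMap := fun f => Empty.elim f
  RelMap := fun r =>
    match r with
    | SetRel.mem => fun v => E (v 0) (v 1)

/-- `C` is a class of `(M, E)`: it is defined in `(M, E)` by a first-order formula of the language
of set theory, with parameters from `M`. -/
def IsClass {M : Type u} (E : M → M → Prop) (C : Set M) : Prop :=
  letI := setStructure E
  (Set.univ : Set M).Definable₁ setLang C

/-- `R` is a class of pairs of elements of `(M, E)`: it is defined in `(M, E)` by a first-order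
formula `φ(x, y)` of the language of set theory, with parameters from `M`. -/
def IsClass₂ {M : Type u} (E : M → M → Prop) (R : Set (M × M)) : Prop :=
  letI := setStructure E
  (Set.univ : Set M).Definable₂ setLang R

section internal

variable {M : Type u} (E : M → M → Prop)

/-- `a ⊆ b` -/
def IsSubset (a b : M) : Prop := ∀ z, E z a → E z b

/-- `a = ∅` -/
def IsEmptySet (a : M) : Prop := ∀ z, ¬ E z a

/-- `u = {a, b}` -/
def IsUPair (u a b : M) : Prop := ∀ z, E z u ↔ z = a ∨ z = b

/-- `p` is the ordered pair `(a, b) = {{a}, {a, b}}`. -/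
def IsPair (p a b : M) : Prop := ∀ u, E u p ↔ IsUPair E u a a ∨ IsUPair E u a b

/-- `s = a ∪ {a}` -/
def IsSucc (s a : M) : Prop := ∀ z, E z s ↔ E z a ∨ z = a

/-- `t` is a transitive set. -/
def IsTransSet (t : M) : Prop := ∀ y, E y t → IsSubset E y t

/-- `t = tc(a)`: the least transitive set that includes `a`. -/
def IsTC (t a : M) : Prop :=
  IsTransSet E t ∧ IsSubset E a t ∧ ∀ s, IsTransSet E s → IsSubset E a s → IsSubset E t s

/-- Every nonempty subset of `t` has an `∈`-minimal element. -/
def WellFoundedOn (t : M) : Prop :=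
  ∀ u, IsSubset E u t → (∃ y, E y u) → ∃ y, E y u ∧ ∀ z, E z u → ¬ E z y

/-- `a` is a (von Neumann) ordinal: a transitive set that is well-ordered by `∈`. -/
def IsOrdinal (a : M) : Prop :=
  IsTransSet E a ∧
  (∀ x, E x a → ¬ E x x) ∧
  (∀ x y z, E x a → E y a → E z a → E x y → E y z → E x z) ∧
  (∀ x y, E x a → E y a → E x y ∨ x = y ∨ E y x) ∧
  WellFoundedOn E a

/-- `(M, E)` is a model of ZF without the Axiom of Regularity. -/
structure IsModelZFMinus : Prop where
  extensionality : ∀ a b, (∀ z, E z a ↔ E z b) → a = b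
  pairing : ∀ a b, ∃ u, IsUPair E u a b
  union : ∀ a, ∃ b, ∀ z, E z b ↔ ∃ y, E y a ∧ E z y
  powerSet : ∀ a, ∃ b, ∀ z, E z b ↔ IsSubset E z a
  infinity : ∃ a, (∃ o, IsEmptySet E o ∧ E o a) ∧
    ∀ x, E x a → ∃ s, IsSucc E s x ∧ E s a
  separation : ∀ C : Set M, IsClass E C → ∀ a, ∃ b, ∀ z, E z b ↔ E z a ∧ z ∈ C
  replacement : ∀ F : Set (M × M), IsClass₂ E F →
    (∀ x y z, (x, y) ∈ F → (x, z) ∈ F → y = z) →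
    ∀ a, ∃ b, ∀ y, E y b ↔ ∃ x, E x a ∧ (x, y) ∈ F

/-- `C` is an inner model of ZF without Regularity in `(M, E)`: a transitive class that contains
all ordinals and satisfies the axioms. -/
structure IsInnerModel (C : Set M) : Prop where
  isClass : IsClass E C
  transitive : ∀ x y, x ∈ C → E y x → y ∈ C
  ordinals : ∀ a, IsOrdinal E a → a ∈ C
  model : IsModelZFMinus (fun x y : C => E x.1 y.1)

/-! The game. A history is a list that records the play so far, latest position first: the history
at the start of the game on `x` is `(x, ∅)`, and if the history is `p` and the player to move
chooses `z`, then the new history is `(z, p)`. -/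

/-- The history `q` arises from the history `p` by one legal move: `p = (y, h)` and `q = (z, p)`
with `z ∈ y`. -/
def Move (p q : M) : Prop := ∃ y h z, IsPair E p y h ∧ E z y ∧ IsPair E q z p

/-- `A` and `B` form a winning strategy for one player, the owner. `A` holds histories at which the
owner is to move and `B` holds histories at which the adversary is to move. The strategy tells the
owner to move from `p ∈ A` to any of the histories in `B` (more than one move may be allowed,
since the axiom of choice is not available). -/
structure IsWinningStrategy (A B : M) : Prop where
  /-- The owner is never stuck. -/
  move : ∀ p, E p A → ∃ q, Move E p q ∧ E q B
  /-- All moves of the adversary are taken into account. -/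
  reply : ∀ p, E p B → ∀ q, Move E p q → E q A
  /-- The plays according to the strategy terminate: the tree of these plays is well-founded. -/
  terminates : ∀ U, (∀ p, E p U → E p A ∨ E p B) → (∃ p, E p U) →
    ∃ p, E p U ∧ ∀ q, E q U → Move E p q → ¬ ((E p A ∧ E q B) ∨ (E p B ∧ E q A))

/-- `r` is the history `(x, ∅)` at the start of the game on `x`. -/
def IsStart (r x : M) : Prop := ∃ o, IsEmptySet E o ∧ IsPair E r x o

/-- Player I, who moves first, has a winning strategy in the game on `x`. -/
def WinningI (x : M) : Prop :=
  ∃ A B r, IsWinningStrategy E A B ∧ IsStart E r x ∧ E r A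

/-- Player II has a winning strategy in the game on `x`. -/
def WinningII (x : M) : Prop :=
  ∃ A B r, IsWinningStrategy E A B ∧ IsStart E r x ∧ E r B

/-- The class `W` of winning sets. -/
def W : Set M := {x | WinningI E x ∨ WinningII E x}

/-- The class `HW` of hereditarily winning sets: `tc({x}) ⊆ W`. -/
def HW : Set M := {x | ∃ s t, IsUPair E s x x ∧ IsTC E t s ∧ ∀ y, E y t → y ∈ W E}

/-- The class `V_∞` of well-founded sets: `∈` is well-founded on `tc({x})`. -/
def VInfty : Set M := {x | ∃ s t, IsUPair E s x x ∧ IsTC E t s ∧ WellFoundedOn E t}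

end internal

end SetGame

/-!
A set all of whose elements are winning is winning: if player II wins on some `y ∈ x`, then player I
wins on `x` by moving to `y`; otherwise player I wins on every element of `x`, so player II wins on
`x`. Hence every set of hereditarily winning sets is hereditarily winning (`mem_HW_of_forall_mem`).
This closure property gives everything else. The sets whose existence the axioms of `ZF⁻` assert
have their elements in `HW` when the axioms are relativized to `HW`, so they belong to `HW`
(`isModelZFMinus_of_forall_mem`); and an `∈`-minimal well-founded set outside `HW` would have all
its elements in `HW`, so `HW` contains `V_∞` and the ordinals (`mem_HW_of_wellFoundedOn`).

The closure property is not immediate because without choice one cannot pick a winning strategy for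
each element of `x`, and combining all of them need not give a terminating strategy. Instead a
single strategy is defined for all positions in a transitive set `t`. The positions of `t` that are
lost for the player to move form the least fixed point of the operator `answerable t`. This fixed
point is built up in stages, a family of sets which is linearly ordered by inclusion
(`IsStage.subset_or`), as in Zermelo's proof of the well-ordering theorem, and which takes the place
of ordinal ranks. Always moving to a lost position that appears at the earliest possible stage is a
terminating strategy (`exists_isWinningStrategy`); conversely no strategy wins from any other
position (`IsWinningStrategy.mem_lost`). So winning on the elements of `t` is described by the set
`lost t`.

Everything takes place inside the given model, so each use of separation, replacement or induction
needs a defining formula. The classes `Dfn` and `DFun` let instance search find these formulas from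
the shape of the properties. Histories and transitive closures come from iterating a definable
function along the natural numbers of the model (`exists_closed_set`).
-/

namespace SetGame

/-! ### Definability with parameters -/

/-- A model of `ZF⁻`, bundled so that its membership relation is found by instance search. -/
class ZFMinusModel (M : Type u) where
  /-- The membership relation of the model. -/
  E : M → M → Prop
  isModel : IsModelZFMinus E

local infix:50 " ε " => ZFMinusModel.E

local infix:50 " ⊑ " => IsSubset ZFMinusModel.E

variable {M : Type u} [ZFMinusModel M]

/-- A property of sequences of elements of the model that is defined by a first-order formula with
parameters; the terms of the sequence stand for the free variables, of which a formula uses finitely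
many. As a class it lets instance search build the defining formula along the shape of `P`. -/
class Dfn (P : (ℕ → M) → Prop) : Prop where
  exists_formula : letI := setStructure (ZFMinusModel.E (M := M))
    ∃ φ : setLang.Formula (M ⊕ ℕ), ∀ v, φ.Realize (Sum.elim id v) ↔ P v

/-- A function on sequences of elements of the model whose graph is definable with parameters; in
the graph, term `0` is the value and the terms from `1` on are the argument. -/
class DFun (f : (ℕ → M) → M) : Prop where
  graph : Dfn fun w => w 0 = f fun i => w (i + 1)

/-- Free variables of a definable property may be renamed, or be replaced by parameters. -/
theorem Dfn.subst {P : (ℕ → M) → Prop} (h : Dfn P) (σ : ℕ → M ⊕ ℕ) :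
    Dfn fun v : ℕ → M => P fun i => Sum.elim id v (σ i) := by
  obtain ⟨φ, hφ⟩ := h
  let := setStructure (ZFMinusModel.E (M := M))
  refine ⟨φ.relabel (Sum.elim Sum.inl σ), fun v => ?_⟩
  rw [FirstOrder.Language.Formula.realize_relabel, ← hφ]
  have : (Sum.elim id v : M ⊕ ℕ → M) ∘ Sum.elim Sum.inl σ =
      Sum.elim id (fun i => Sum.elim id v (σ i)) := by
    ext x; cases x <;> rfl
  rw [this]

theorem Dfn.rename {P : (ℕ → M) → Prop} (h : Dfn P) (σ : ℕ → ℕ) :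
    Dfn fun v : ℕ → M => P fun i => v (σ i) := h.subst fun i => Sum.inr (σ i)

instance Dfn.const (p : Prop) : Dfn fun _ : ℕ → M => p := by
  let := setStructure (ZFMinusModel.E (M := M))
  by_cases hp : p
  · exact ⟨⊤, fun v => by simp [hp]⟩
  · exact ⟨⊥, fun v => by simp [hp]⟩

instance Dfn.imp (P Q : (ℕ → M) → Prop) [hP : Dfn P] [hQ : Dfn Q] : Dfn fun v => P v → Q v := by
  obtain ⟨φ, hφ⟩ := hP
  obtain ⟨ψ, hψ⟩ := hQ
  let := setStructure (ZFMinusModel.E (M := M))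
  exact ⟨φ.imp ψ, fun v => by rw [FirstOrder.Language.Formula.realize_imp, hφ, hψ]⟩

instance Dfn.not (P : (ℕ → M) → Prop) [Dfn P] : Dfn fun v => ¬ P v :=
  inferInstanceAs (Dfn fun v => P v → False)

theorem Dfn.congr {P Q : (ℕ → M) → Prop} (h : Dfn P) (e : ∀ v, P v ↔ Q v) : Dfn Q := by
  rwa [← (funext fun v => propext (e v) : P = Q)]

instance Dfn.and (P Q : (ℕ → M) → Prop) [Dfn P] [Dfn Q] : Dfn fun v => P v ∧ Q v :=
  Dfn.congr (P := fun v => ¬ (P v → ¬ Q v)) inferInstance fun v => by tauto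

instance Dfn.or (P Q : (ℕ → M) → Prop) [Dfn P] [Dfn Q] : Dfn fun v => P v ∨ Q v :=
  Dfn.congr (P := fun v => ¬ P v → Q v) inferInstance fun v => by tauto

instance Dfn.iff (P Q : (ℕ → M) → Prop) [Dfn P] [Dfn Q] : Dfn fun v => P v ↔ Q v :=
  Dfn.congr (P := fun v => (P v → Q v) ∧ (Q v → P v)) inferInstance fun v => by tauto

/-- Under a quantifier the context is shifted: term `0` is the bound variable. -/
instance Dfn.exists (Q : (ℕ → M) → M → Prop) [h : Dfn fun w => Q (fun i => w (i + 1)) (w 0)] :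
    Dfn fun v => ∃ x, Q v x := by
  obtain ⟨φ, hφ⟩ := h
  let := setStructure (ZFMinusModel.E (M := M))
  refine ⟨(φ.relabel (Sum.elim (fun m => Sum.inl (Sum.inl m))
    (fun n => Nat.casesOn n (Sum.inr 0) (fun k => Sum.inl (Sum.inr k))) :
      M ⊕ ℕ → (M ⊕ ℕ) ⊕ Fin 1)).iExs (Fin 1), fun v => ?_⟩
  rw [FirstOrder.Language.Formula.realize_iExs]
  have key : ∀ i : Fin 1 → M, (φ.relabel (Sum.elim (fun m => Sum.inl (Sum.inl m))
      (fun n => Nat.casesOn n (Sum.inr 0) (fun k => Sum.inl (Sum.inr k))) :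
        M ⊕ ℕ → (M ⊕ ℕ) ⊕ Fin 1)).Realize (Sum.elim (Sum.elim id v) i) ↔ Q v (i 0) := by
    intro i
    rw [FirstOrder.Language.Formula.realize_relabel]
    have : (Sum.elim (Sum.elim id v) i ∘ (Sum.elim (fun m => Sum.inl (Sum.inl m))
      (fun n => Nat.casesOn n (Sum.inr 0) (fun k => Sum.inl (Sum.inr k))) :
        M ⊕ ℕ → (M ⊕ ℕ) ⊕ Fin 1)) =
        Sum.elim id (fun n => Nat.casesOn n (i 0) v : ℕ → M) := by
      ext x
      rcases x with x | x
      · rfl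
      · cases x <;> rfl
    rw [this, hφ]
    exact Iff.rfl
  exact ⟨fun ⟨i, hi⟩ => ⟨i 0, (key i).1 hi⟩, fun ⟨x, hx⟩ => ⟨fun _ => x, (key _).2 hx⟩⟩

instance Dfn.forall (Q : (ℕ → M) → M → Prop) [Dfn fun w => Q (fun i => w (i + 1)) (w 0)] :
    Dfn fun v => ∀ x, Q v x :=
  Dfn.congr (P := fun v => ¬ ∃ x, ¬ Q v x) inferInstance fun v => by simp

theorem Dfn.mem_var (i j : ℕ) : Dfn fun v : ℕ → M => v i ε v j := by
  let := setStructure (ZFMinusModel.E (M := M))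
  refine ⟨FirstOrder.Language.Relations.formula₂ (L := setLang)
    (show setLang.Relations 2 from SetRel.mem)
    (FirstOrder.Language.Term.var (Sum.inr i)) (FirstOrder.Language.Term.var (Sum.inr j)),
    fun v => ?_⟩
  exact FirstOrder.Language.Formula.realize_rel₂

theorem Dfn.eq_var (i j : ℕ) : Dfn fun v : ℕ → M => v i = v j :=
  Dfn.congr (P := fun v => ∀ x, x ε v i ↔ x ε v j)
    (have := Dfn.mem_var (M := M) 0 (i + 1)
     have := Dfn.mem_var (M := M) 0 (j + 1)
     inferInstance)
    fun v => ⟨ZFMinusModel.isModel.extensionality _ _, fun h => by simp [h]⟩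

instance DFun.var (i : ℕ) : DFun fun v : ℕ → M => v i := ⟨Dfn.eq_var _ _⟩

instance DFun.const (c : M) : DFun fun _ : ℕ → M => c :=
  ⟨(Dfn.subst (Dfn.eq_var (M := M) 0 1) fun i =>
    match i with | 0 => Sum.inr 0 | _ + 1 => Sum.inl c).congr fun _ => Iff.rfl⟩

theorem DFun.rename {f : (ℕ → M) → M} (h : DFun f) (σ : ℕ → ℕ) :
    DFun fun v : ℕ → M => f fun i => v (σ i) :=
  ⟨h.graph.rename fun i => Nat.casesOn i 0 fun k => σ k + 1⟩

/-- Substitution of a definable function for a variable. -/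
theorem Dfn.comp {P : (ℕ → M) → M → Prop} (h : Dfn fun w => P (fun i => w (i + 1)) (w 0))
    (f : (ℕ → M) → M) [hf : DFun f] : Dfn fun v => P v (f v) :=
  have := hf.graph
  Dfn.congr (P := fun v => ∃ y, y = f v ∧ P v y) inferInstance fun v => by simp

theorem Dfn.comp₁ {P : M → Prop} (h : Dfn fun w : ℕ → M => P (w 0))
    (f : (ℕ → M) → M) [DFun f] : Dfn fun v => P (f v) :=
  Dfn.comp (P := fun _ => P) h f

theorem Dfn.comp₂ {P : M → M → Prop} (h : Dfn fun w : ℕ → M => P (w 0) (w 1))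
    (f g : (ℕ → M) → M) [DFun f] [hg : DFun g] : Dfn fun v => P (f v) (g v) := by
  refine Dfn.comp (P := fun v x => P x (g v)) ?_ f
  have := hg.rename (· + 1)
  refine Dfn.comp (P := fun v x => P (v 0) x) ?_ (fun w => g fun i => w (i + 1))
  exact h.rename fun i => Nat.casesOn i 1 fun _ => 0

instance Dfn.mem (f g : (ℕ → M) → M) [DFun f] [DFun g] : Dfn fun v => f v ε g v :=
  Dfn.comp₂ (Dfn.mem_var 0 1) f g

instance Dfn.eq (f g : (ℕ → M) → M) [DFun f] [DFun g] : Dfn fun v => f v = g v :=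
  Dfn.comp₂ (Dfn.eq_var 0 1) f g

theorem DFun.comp {F : (ℕ → M) → M → M} (h : DFun fun w => F (fun i => w (i + 1)) (w 0))
    (f : (ℕ → M) → M) [hf : DFun f] : DFun fun v => F v (f v) := by
  have := hf.rename (· + 1)
  refine ⟨Dfn.comp (P := fun w x => w 0 = F (fun i => w (i + 1)) x) ?_
    (fun w => f fun i => w (i + 1))⟩
  have := h.rename fun i => Nat.casesOn i 0 fun k => k + 2
  exact Dfn.eq (fun w => w 1) _

theorem DFun.comp₁ {F : M → M} (h : DFun fun w : ℕ → M => F (w 0))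
    (f : (ℕ → M) → M) [DFun f] : DFun fun v => F (f v) :=
  DFun.comp (F := fun _ => F) h f

theorem DFun.comp₂ {F : M → M → M} (h : DFun fun w : ℕ → M => F (w 0) (w 1))
    (f g : (ℕ → M) → M) [DFun f] [hg : DFun g] : DFun fun v => F (f v) (g v) := by
  refine DFun.comp (F := fun v x => F x (g v)) ?_ f
  have := hg.rename (· + 1)
  refine DFun.comp (F := fun v x => F (v 0) x) ?_ (fun w => g fun i => w (i + 1))
  exact h.rename fun i => Nat.casesOn i 1 fun _ => 0

theorem isClass_of_dfn {P : M → Prop} (h : Dfn fun w : ℕ → M => P (w 0)) :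
    IsClass ZFMinusModel.E {x | P x} := by
  obtain ⟨φ, hφ⟩ := h
  let := setStructure (ZFMinusModel.E (M := M))
  refine Set.definable_iff_exists_formula_sum.2
    ⟨φ.relabel (Sum.map (fun m => ⟨m, trivial⟩) fun _ => 0), ?_⟩
  ext v
  simp only [Set.mem_ofPred_eq, FirstOrder.Language.Formula.realize_relabel]
  rw [show (Sum.elim (fun a : (Set.univ : Set M) => (a : M)) v ∘
    Sum.map (fun m => ⟨m, trivial⟩) fun _ => 0) = Sum.elim id (fun _ => v 0 : ℕ → M) by
      ext x; cases x <;> rfl]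
  exact (hφ fun _ => v 0).symm

theorem isClass₂_of_dfn {R : M → M → Prop} (h : Dfn fun w : ℕ → M => R (w 0) (w 1)) :
    IsClass₂ ZFMinusModel.E {p | R p.1 p.2} := by
  obtain ⟨φ, hφ⟩ := h
  let := setStructure (ZFMinusModel.E (M := M))
  refine Set.definable_iff_exists_formula_sum.2
    ⟨φ.relabel (Sum.map (fun m => ⟨m, trivial⟩) fun n => Nat.casesOn n 0 fun _ => 1), ?_⟩
  ext v
  simp only [Set.mem_ofPred_eq, FirstOrder.Language.Formula.realize_relabel]
  rw [show (Sum.elim (fun a : (Set.univ : Set M) => (a : M)) v ∘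
    Sum.map (fun m => ⟨m, trivial⟩) fun n => Nat.casesOn n 0 fun _ => 1) =
      Sum.elim id (fun n => Nat.casesOn n (v 0) fun _ => v 1 : ℕ → M) by
      ext x; rcases x with x | x
      · rfl
      · cases x <;> rfl]
  exact (hφ fun n => Nat.casesOn n (v 0) fun _ => v 1).symm

instance Dfn.isSubset (a b : (ℕ → M) → M) [ha : DFun a] [hb : DFun b] :
    Dfn fun v => a v ⊑ b v := by
  refine Dfn.comp₂ ?_ a b
  unfold IsSubset; infer_instance

instance Dfn.isTransSet (a : (ℕ → M) → M) [DFun a] :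
    Dfn fun v => IsTransSet ZFMinusModel.E (a v) := by
  refine Dfn.comp₁ ?_ a
  unfold IsTransSet; infer_instance

instance Dfn.isTC (a b : (ℕ → M) → M) [DFun a] [DFun b] :
    Dfn fun v => IsTC ZFMinusModel.E (a v) (b v) := by
  refine Dfn.comp₂ ?_ a b
  unfold IsTC; infer_instance

/-! ### Set-theoretic operations inside the model -/

theorem ext_set {a b : M} (h : ∀ z, z ε a ↔ z ε b) : a = b :=
  ZFMinusModel.isModel.extensionality a b h

theorem exists_sep (a : M) (P : M → Prop) [h : Dfn fun w : ℕ → M => P (w 0)] :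
    ∃ b, ∀ z, z ε b ↔ z ε a ∧ P z :=
  ZFMinusModel.isModel.separation _ (isClass_of_dfn h) a

theorem exists_image (F : M → M) (a : M) [h : DFun fun w : ℕ → M => F (w 0)] :
    ∃ b, ∀ y, y ε b ↔ ∃ x, x ε a ∧ y = F x :=
  ZFMinusModel.isModel.replacement _
    (isClass₂_of_dfn (R := fun x y => y = F x) (Dfn.eq (fun w => w 1) _))
    (fun _ _ _ h₁ h₂ => h₁.trans h₂.symm) a

open Classical in
/-- The set `{z ∈ a | P z}`, with value `a` if this is not a set of the model. -/
noncomputable def sep (a : M) (P : M → Prop) : M :=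
  if h : ∃ b, ∀ z, z ε b ↔ z ε a ∧ P z then h.choose else a

theorem mem_sep {a z : M} {P : M → Prop} [Dfn fun w : ℕ → M => P (w 0)] :
    z ε sep a P ↔ z ε a ∧ P z := by
  have h := exists_sep a P
  rw [sep, dif_pos h]
  exact h.choose_spec z

open Classical in
/-- The set `{F x | x ∈ a}`, with value `a` if this is not a set of the model. -/
noncomputable def image (F : M → M) (a : M) : M :=
  if h : ∃ b, ∀ y, y ε b ↔ ∃ x, x ε a ∧ y = F x then h.choose else a

theorem mem_image {F : M → M} {a y : M} [DFun fun w : ℕ → M => F (w 0)] :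
    y ε image F a ↔ ∃ x, x ε a ∧ y = F x := by
  have h := exists_image F a
  rw [image, dif_pos h]
  exact h.choose_spec y

/-- The unordered pair `{a, b}`. -/
noncomputable def upair (a b : M) : M := (ZFMinusModel.isModel.pairing a b).choose

/-- The union `⋃ a`. -/
noncomputable def sUnion (a : M) : M := (ZFMinusModel.isModel.union a).choose

/-- The power set of `a`. -/
noncomputable def power (a : M) : M := (ZFMinusModel.isModel.powerSet a).choose

variable (M) in
/-- The empty set. -/
noncomputable def emp : M :=
  (ZFMinusModel.isModel (M := M)).infinity.choose_spec.1.choose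

/-- The ordered pair `(a, b)`. -/
noncomputable def pair (a b : M) : M := upair (upair a a) (upair a b)

/-- The successor `a ∪ {a}`. -/
noncomputable def succ (a : M) : M := sUnion (upair a (upair a a))

/-- The Cartesian product `a × b`. -/
noncomputable def prod (a b : M) : M := sUnion (image (fun x => image (pair x) b) a)

theorem isUPair_upair (a b : M) : IsUPair ZFMinusModel.E (upair a b) a b :=
  (ZFMinusModel.isModel.pairing a b).choose_spec

theorem mem_upair {a b z : M} : z ε upair a b ↔ z = a ∨ z = b := isUPair_upair a b z

theorem mem_sUnion {a z : M} : z ε sUnion a ↔ ∃ y, y ε a ∧ z ε y :=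
  (ZFMinusModel.isModel.union a).choose_spec z

theorem mem_power {a z : M} : z ε power a ↔ z ⊑ a :=
  (ZFMinusModel.isModel.powerSet a).choose_spec z

theorem not_mem_emp {z : M} : ¬ z ε emp M :=
  (ZFMinusModel.isModel (M := M)).infinity.choose_spec.1.choose_spec.1 z

theorem mem_succ {a z : M} : z ε succ a ↔ z ε a ∨ z = a := by
  simp [succ, mem_sUnion, mem_upair]

theorem isUPair_iff {u a b : M} : IsUPair ZFMinusModel.E u a b ↔ u = upair a b :=
  ⟨fun h => ext_set fun z => by rw [h z, mem_upair], fun h => h ▸ isUPair_upair a b⟩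

theorem isPair_iff {p a b : M} : IsPair ZFMinusModel.E p a b ↔ p = pair a b := by
  simp only [IsPair, isUPair_iff]
  exact ⟨fun h => ext_set fun z => by rw [h z, pair, mem_upair],
    fun h u => by rw [h, pair, mem_upair]⟩

theorem isEmptySet_iff {o : M} : IsEmptySet ZFMinusModel.E o ↔ o = emp M :=
  ⟨fun h => ext_set fun z => iff_of_false (h z) not_mem_emp, fun h _ => h ▸ not_mem_emp⟩

theorem isSucc_iff {s a : M} : IsSucc ZFMinusModel.E s a ↔ s = succ a :=
  ⟨fun h => ext_set fun z => by rw [h z, mem_succ], fun h z => by rw [h, mem_succ]⟩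

theorem upair_left_inj {a b c : M} (h : upair a b = upair a c) : b = c := by
  have h₁ : b = a ∨ b = c := by rw [← mem_upair, ← h, mem_upair]; exact Or.inr rfl
  have h₂ : c = a ∨ c = b := by rw [← mem_upair, h, mem_upair]; exact Or.inr rfl
  grind

theorem pair_inj {a b c d : M} : pair a b = pair c d ↔ a = c ∧ b = d := by
  refine ⟨fun h => ?_, by rintro ⟨rfl, rfl⟩; rfl⟩
  have h₁ : upair c c = upair a a ∨ upair c c = upair a b := by
    rw [← mem_upair, ← pair, h, pair, mem_upair]; exact Or.inl rfl
  have hac : a = c := by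
    have : a ε upair c c := by
      rcases h₁ with h | h <;> rw [h, mem_upair] <;> exact Or.inl rfl
    simpa [mem_upair] using this
  subst hac
  exact ⟨rfl, upair_left_inj (upair_left_inj h)⟩

instance DFun.upair (a b : (ℕ → M) → M) [DFun a] [DFun b] : DFun fun v => upair (a v) (b v) :=
  DFun.comp₂ ⟨Dfn.congr (P := fun w => IsUPair ZFMinusModel.E (w 0) (w 1) (w 2))
    (by unfold IsUPair; infer_instance) fun _ => isUPair_iff⟩ a b

instance DFun.pair (a b : (ℕ → M) → M) [DFun a] [DFun b] : DFun fun v => pair (a v) (b v) := by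
  unfold SetGame.pair; infer_instance

instance DFun.sUnion (a : (ℕ → M) → M) [DFun a] : DFun fun v => sUnion (a v) :=
  DFun.comp₁ ⟨Dfn.congr (P := fun w => ∀ z, z ε w 0 ↔ ∃ y, y ε w 1 ∧ z ε y) inferInstance fun w =>
    ⟨fun h => ext_set fun z => by rw [h z, mem_sUnion], fun h z => by rw [h, mem_sUnion]⟩⟩ a

instance DFun.succ (a : (ℕ → M) → M) [DFun a] : DFun fun v => succ (a v) := by
  unfold SetGame.succ; infer_instance

instance DFun.sep (a : (ℕ → M) → M) (P : (ℕ → M) → M → Prop) [DFun a]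
    [h : Dfn fun w => P (fun i => w (i + 1)) (w 0)] : DFun fun v => sep (a v) (P v) := by
  refine DFun.comp (F := fun v x => SetGame.sep x (P v)) ⟨?_⟩ a
  have hv : ∀ v : ℕ → M, Dfn fun w : ℕ → M => P v (w 0) := fun v =>
    (h.subst fun i => match i with | 0 => Sum.inr 0 | i + 1 => Sum.inl (v i)).congr fun _ => Iff.rfl
  have : Dfn fun w : ℕ → M => P (fun i => w (i + 3)) (w 0) :=
    (h.rename fun i => match i with | 0 => 0 | i + 1 => i + 3).congr fun _ => Iff.rfl
  exact Dfn.congr (P := fun w => ∀ z, z ε w 0 ↔ z ε w 1 ∧ P (fun i => w (i + 2)) z) inferInstance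
    fun w => ⟨fun e => ext_set fun z => by rw [e z, mem_sep], fun e z => by rw [e, mem_sep]⟩

instance DFun.image (F : (ℕ → M) → M → M) (a : (ℕ → M) → M) [DFun a]
    [h : DFun fun w => F (fun i => w (i + 1)) (w 0)] : DFun fun v => image (F v) (a v) := by
  refine DFun.comp (F := fun v x => SetGame.image (F v) x) ⟨?_⟩ a
  have hv : ∀ v : ℕ → M, DFun fun w : ℕ → M => F v (w 0) := fun v =>
    ⟨(h.graph.subst fun i => match i with
      | 0 => Sum.inr 0 | 1 => Sum.inr 1 | i + 2 => Sum.inl (v i)).congr fun _ => Iff.rfl⟩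
  have : DFun fun w : ℕ → M => F (fun i => w (i + 4)) (w 0) :=
    ⟨(h.graph.rename fun i => match i with
      | 0 => 0 | 1 => 1 | i + 2 => i + 5).congr fun _ => Iff.rfl⟩
  exact Dfn.congr (P := fun w => ∀ y, y ε w 0 ↔ ∃ x, x ε w 1 ∧ y = F (fun i => w (i + 2)) x)
    inferInstance
    fun w => ⟨fun e => ext_set fun z => by rw [e z, mem_image], fun e z => by rw [e, mem_image]⟩

theorem mem_prod {a b z : M} : z ε prod a b ↔ ∃ x y, x ε a ∧ y ε b ∧ z = pair x y := by
  rw [prod, mem_sUnion]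
  constructor
  · rintro ⟨s, hs, hz⟩
    obtain ⟨x, hx, rfl⟩ := mem_image.1 hs
    obtain ⟨y, hy, rfl⟩ := mem_image.1 hz
    exact ⟨x, y, hx, hy, rfl⟩
  · rintro ⟨x, y, hx, hy, rfl⟩
    exact ⟨_, mem_image.2 ⟨x, hx, rfl⟩, mem_image.2 ⟨y, hy, rfl⟩⟩

instance DFun.prod (a b : (ℕ → M) → M) [DFun a] [DFun b] : DFun fun v => prod (a v) (b v) := by
  unfold SetGame.prod
  exact DFun.comp₂ (F := fun a b => SetGame.sUnion (SetGame.image (fun x =>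
    SetGame.image (SetGame.pair x) b) a)) inferInstance a b

/-! ### Natural numbers and iteration of a definable function -/

/-- `a` contains the empty set and is closed under successors. -/
def IsInductive (a : M) : Prop := emp M ε a ∧ ∀ x, x ε a → succ x ε a

instance Dfn.isInductive (a : (ℕ → M) → M) [DFun a] : Dfn fun v => IsInductive (a v) := by
  refine Dfn.comp₁ ?_ a
  unfold IsInductive; infer_instance

theorem exists_isInductive : ∃ a : M, IsInductive a := by
  obtain ⟨a, ⟨o, ho, hoa⟩, h⟩ := (ZFMinusModel.isModel (M := M)).infinity
  refine ⟨a, isEmptySet_iff.1 ho ▸ hoa, fun x hx => ?_⟩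
  obtain ⟨s, hs, hsa⟩ := h x hx
  exact isSucc_iff.1 hs ▸ hsa

variable (M) in
/-- The set of natural numbers of the model: the least inductive set. -/
noncomputable def omega : M :=
  sep (exists_isInductive (M := M)).choose fun n => ∀ a, IsInductive a → n ε a

theorem mem_omega {n : M} : n ε omega M ↔ ∀ a, IsInductive a → n ε a := by
  rw [omega, mem_sep]
  exact ⟨fun h => h.2, fun h => ⟨h _ exists_isInductive.choose_spec, h⟩⟩

theorem emp_mem_omega : emp M ε omega M := mem_omega.2 fun _ h => h.1

theorem succ_mem_omega {n : M} (h : n ε omega M) : succ n ε omega M :=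
  mem_omega.2 fun a ha => ha.2 n (mem_omega.1 h a ha)

theorem omega_induction {P : M → Prop} [Dfn fun w : ℕ → M => P (w 0)] (zero : P (emp M))
    (step : ∀ n, n ε omega M → P n → P (succ n)) (n : M) (hn : n ε omega M) : P n := by
  have h : IsInductive (sep (omega M) P) := by
    refine ⟨mem_sep.2 ⟨emp_mem_omega, zero⟩, fun x hx => ?_⟩
    have hx := mem_sep.1 hx
    exact mem_sep.2 ⟨succ_mem_omega hx.1, step x hx.1 hx.2⟩
  exact (mem_sep.1 (mem_omega.1 hn _ h)).2

theorem isTransSet_of_mem_omega (n : M) (hn : n ε omega M) :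
    IsTransSet ZFMinusModel.E n := by
  refine omega_induction (P := fun n => IsTransSet ZFMinusModel.E n)
    (fun y hy => (not_mem_emp hy).elim) (fun n _ ih y hy z hz => ?_) n hn
  rcases mem_succ.1 hy with h | rfl
  · exact mem_succ.2 (Or.inl (ih y h z hz))
  · exact mem_succ.2 (Or.inl hz)

theorem not_mem_self_of_mem_omega (n : M) (hn : n ε omega M) : ¬ n ε n := by
  refine omega_induction (P := fun n => ¬ n ε n) not_mem_emp (fun n hn ih h => ?_) n hn
  rcases mem_succ.1 h with h | h
  · exact ih (isTransSet_of_mem_omega n hn _ h _ (mem_succ.2 (Or.inr rfl)))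
  · exact ih (by have := mem_succ.2 (Or.inr (rfl : n = n)); rwa [h] at this)

theorem succ_inj_of_mem_omega {m n : M} (hn : n ε omega M) (h : succ m = succ n) : m = n := by
  by_contra hne
  have h₁ : m ε n := (mem_succ.1 (h ▸ mem_succ.2 (Or.inr rfl) : m ε succ n)).resolve_right hne
  have h₂ : n ε m :=
    (mem_succ.1 (h.symm ▸ mem_succ.2 (Or.inr rfl) : n ε succ m)).resolve_right (Ne.symm hne)
  exact not_mem_self_of_mem_omega n hn (isTransSet_of_mem_omega n hn m h₁ n h₂)

theorem succ_ne_emp (n : M) : succ n ≠ emp M := fun h =>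
  not_mem_emp (h ▸ mem_succ.2 (Or.inr rfl) : n ε emp M)

/-- `f` witnesses steps of the iteration of `F` at `a`: each element of `f` is `(0, a)` or is
`(k + 1, F w)` for some `(k, w) ∈ f`. -/
def IsIterationWitness (F : M → M) (a f : M) : Prop :=
  ∀ p, p ε f → p = pair (emp M) a ∨ ∃ k w, pair k w ε f ∧ p = pair (succ k) (F w)

/-- `y = Fⁿ(a)` -/
def IsIterate (F : M → M) (a n y : M) : Prop := ∃ f, IsIterationWitness F a f ∧ pair n y ε f

theorem dfn_isIterate (F : M → M) (a : M) [hF : DFun fun w : ℕ → M => F (w 0)]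
    (n y : (ℕ → M) → M) [DFun n] [DFun y] : Dfn fun v => IsIterate F a (n v) (y v) := by
  refine Dfn.comp₂ ?_ n y
  have (s : (ℕ → M) → M) [DFun s] : DFun fun v => F (s v) := DFun.comp₁ hF s
  unfold IsIterate IsIterationWitness; infer_instance

theorem isIterate_zero (F : M → M) (a : M) : IsIterate F a (emp M) a :=
  ⟨upair (pair (emp M) a) (pair (emp M) a), fun p hp => Or.inl (by simpa [mem_upair] using hp),
    mem_upair.2 (Or.inl rfl)⟩

theorem IsIterate.succ {F : M → M} {a n y : M} (h : IsIterate F a n y) :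
    IsIterate F a (succ n) (F y) := by
  obtain ⟨f, hf, hn⟩ := h
  have key : ∀ p, p ε sUnion (upair f (upair (pair (SetGame.succ n) (F y))
      (pair (SetGame.succ n) (F y)))) ↔ p ε f ∨ p = pair (SetGame.succ n) (F y) := by
    simp [mem_sUnion, mem_upair]
  refine ⟨_, fun p hp => ?_, (key _).2 (Or.inr rfl)⟩
  rcases (key p).1 hp with hp | rfl
  · rcases hf p hp with h | ⟨k, w, h, e⟩
    · exact Or.inl h
    · exact Or.inr ⟨k, w, (key _).2 (Or.inl h), e⟩
  · exact Or.inr ⟨n, y, (key _).2 (Or.inl hn), rfl⟩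

theorem IsIterate.unique (F : M → M) (a : M) [DFun fun w : ℕ → M => F (w 0)] (n : M)
    (hn : n ε omega M) : ∀ y y', IsIterate F a n y → IsIterate F a n y' → y = y' := by
  have := dfn_isIterate F a
  refine omega_induction (P := fun n => ∀ y y', IsIterate F a n y → IsIterate F a n y' → y = y')
    ?_ ?_ n hn
  · rintro y y' ⟨f, hf, h⟩ ⟨f', hf', h'⟩
    have aux : ∀ f y, IsIterationWitness F a f → pair (emp M) y ε f → y = a := by
      intro f y hf h
      rcases hf _ h with e | ⟨k, w, -, e⟩
      · exact (pair_inj.1 e).2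
      · exact (succ_ne_emp k (pair_inj.1 e).1.symm).elim
    rw [aux f y hf h, aux f' y' hf' h']
  · intro n hn ih y y' hy hy'
    have aux : ∀ y, IsIterate F a (SetGame.succ n) y → ∃ w, IsIterate F a n w ∧ y = F w := by
      rintro y ⟨f, hf, h⟩
      rcases hf _ h with e | ⟨k, w, hk, e⟩
      · exact (succ_ne_emp n (pair_inj.1 e).1).elim
      · obtain ⟨e₁, e₂⟩ := pair_inj.1 e
        obtain rfl := succ_inj_of_mem_omega hn e₁.symm
        exact ⟨w, ⟨f, hf, hk⟩, e₂⟩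
    obtain ⟨w, hw, rfl⟩ := aux y hy
    obtain ⟨w', hw', rfl⟩ := aux y' hy'
    rw [ih w w' hw hw']

/-- Replacement along `ω`: the iterates of a definable function form a set. -/
theorem exists_closed_set (F : M → M) (a : M) [DFun fun w : ℕ → M => F (w 0)] :
    ∃ S, a ε S ∧ ∀ s, s ε S → F s ε S := by
  have := dfn_isIterate F a
  obtain ⟨S, hS⟩ := ZFMinusModel.isModel.replacement
    {p : M × M | p.1 ε omega M ∧ IsIterate F a p.1 p.2}
    (isClass₂_of_dfn (R := fun n y => n ε omega M ∧ IsIterate F a n y) inferInstance)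
    (fun n y y' h h' => IsIterate.unique F a n h.1 y y' h.2 h'.2) (omega M)
  refine ⟨S, (hS a).2 ⟨_, emp_mem_omega, emp_mem_omega, isIterate_zero F a⟩, fun s hs => ?_⟩
  obtain ⟨n, hn, -, h⟩ := (hS s).1 hs
  exact (hS _).2 ⟨_, succ_mem_omega hn, succ_mem_omega hn, h.succ⟩

theorem exists_isTransSet (a : M) :
    ∃ t, IsTransSet ZFMinusModel.E t ∧ a ⊑ t := by
  obtain ⟨S, ha, hS⟩ := exists_closed_set (fun s : M => sUnion s) a
  refine ⟨sUnion S, fun y hy z hz => ?_, fun z hz => mem_sUnion.2 ⟨a, ha, hz⟩⟩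
  obtain ⟨s, hs, hys⟩ := mem_sUnion.1 hy
  exact mem_sUnion.2 ⟨_, hS s hs, mem_sUnion.2 ⟨y, hys, hz⟩⟩

theorem exists_isTC (a : M) : ∃ t, IsTC ZFMinusModel.E t a := by
  obtain ⟨T, hT, haT⟩ := exists_isTransSet a
  have key : ∀ z, z ε sep T (fun z => ∀ s, IsTransSet ZFMinusModel.E s →
      a ⊑ s → z ε s) ↔
      ∀ s, IsTransSet ZFMinusModel.E s →
        a ⊑ s → z ε s := fun z =>
    mem_sep.trans ⟨fun h => h.2, fun h => ⟨h T hT haT, h⟩⟩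
  exact ⟨_, fun y hy z hz => (key z).2 fun s hs has => hs y ((key y).1 hy s hs has) z hz,
    fun z hz => (key z).2 fun s _ has => has z hz, fun s hs has z hz => (key z).1 hz s hs has⟩

/-! ### Positions that are lost for the player to move -/

/-- The positions in `t` from which every move can be answered by a move into `s`. -/
noncomputable def answerable (t s : M) : M := sep t fun y => ∀ z, z ε y → ∃ w, w ε z ∧ w ε s

theorem mem_answerable {t s y : M} :
    y ε answerable t s ↔ y ε t ∧ ∀ z, z ε y → ∃ w, w ε z ∧ w ε s := mem_sep

instance DFun.answerable (t s : (ℕ → M) → M) [DFun t] [DFun s] :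
    DFun fun v => answerable (t v) (s v) :=
  DFun.comp₂ (F := SetGame.answerable) (by unfold SetGame.answerable; infer_instance) t s

theorem answerable_mono {t s s' : M} (h : s ⊑ s') : answerable t s ⊑ answerable t s' := by
  intro y hy
  obtain ⟨hyt, hy⟩ := mem_answerable.1 hy
  refine mem_answerable.2 ⟨hyt, fun z hz => ?_⟩
  obtain ⟨w, hw, hws⟩ := hy z hz
  exact ⟨w, hw, h w hws⟩

/-- `F` is closed under `answerable t` and under unions. -/
def IsStageFamily (t F : M) : Prop :=
  (∀ s, s ε F → answerable t s ε F) ∧ ∀ X, X ⊑ F → sUnion X ε F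

/-- The stages of the inductive construction of the lost positions in `t`: the members of the least
family that is closed under `answerable t` and under unions. Stages take the place of ordinal ranks
of lost positions. -/
def IsStage (t s : M) : Prop := ∀ F, IsStageFamily t F → s ε F

instance Dfn.isStage (t s : (ℕ → M) → M) [DFun t] [DFun s] : Dfn fun v => IsStage (t v) (s v) := by
  refine Dfn.comp₂ ?_ t s
  unfold IsStage IsStageFamily; infer_instance

theorem isStageFamily_power (t : M) : IsStageFamily t (power t) := by
  refine ⟨fun s _ => mem_power.2 fun y hy => (mem_answerable.1 hy).1,
    fun X hX => mem_power.2 fun y hy => ?_⟩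
  obtain ⟨s, hs, hy⟩ := mem_sUnion.1 hy
  exact mem_power.1 (hX s hs) y hy

variable {t : M}

theorem IsStage.subset {s : M} (hs : IsStage t s) : s ⊑ t :=
  mem_power.1 (hs _ (isStageFamily_power t))

theorem IsStage.answerable {s : M} (hs : IsStage t s) : IsStage t (answerable t s) :=
  fun F hF => hF.1 s (hs F hF)

theorem IsStage.sUnion {X : M} (hX : ∀ s, s ε X → IsStage t s) : IsStage t (sUnion X) :=
  fun F hF => hF.2 X fun s hs => hX s hs F hF

theorem stage_induction {P : M → Prop} [Dfn fun w : ℕ → M => P (w 0)]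
    (step : ∀ s, IsStage t s → P s → P (answerable t s))
    (union : ∀ X, (∀ s, s ε X → IsStage t s) → (∀ s, s ε X → P s) → P (sUnion X))
    (s : M) (hs : IsStage t s) : P s := by
  have key : ∀ s, s ε sep (power t) (fun s => IsStage t s ∧ P s) ↔ IsStage t s ∧ P s := fun s =>
    mem_sep.trans ⟨fun h => h.2, fun h => ⟨mem_power.2 h.1.subset, h⟩⟩
  refine ((key s).1 (hs _ ⟨fun s hs => ?_, fun X hX => ?_⟩)).2
  · obtain ⟨h, hP⟩ := (key s).1 hs
    exact (key _).2 ⟨h.answerable, step s h hP⟩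
  · have hX := fun s hs => (key s).1 (hX s hs)
    exact (key _).2 ⟨IsStage.sUnion fun s hs => (hX s hs).1,
      union X (fun s hs => (hX s hs).1) fun s hs => (hX s hs).2⟩

theorem IsStage.subset_answerable (s : M) (hs : IsStage t s) : s ⊑ SetGame.answerable t s := by
  refine stage_induction (P := fun s => s ⊑ SetGame.answerable t s) (fun s _ h => answerable_mono h)
    (fun X _ h y hy => ?_) s hs
  obtain ⟨r, hr, hy⟩ := mem_sUnion.1 hy
  exact answerable_mono (fun z hz => mem_sUnion.2 ⟨r, hr, hz⟩) y (h r hr y hy)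

theorem subset_antisymm {a b : M} (h : a ⊑ b) (h' : b ⊑ a) : a = b :=
  ext_set fun z => ⟨h z, h' z⟩

/-- Every stage is included in `c` or includes the stage after `c`, provided that no stage `x ⊊ c`
jumps over `c`, in the sense that the stage after `x` is not included in `c`. -/
theorem stage_dichotomy {c : M}
    (hc : ∀ x, IsStage t x → x ⊑ c → x ≠ c → answerable t x ⊑ c) (x : M) (hx : IsStage t x) :
    x ⊑ c ∨ answerable t c ⊑ x := by
  refine stage_induction (P := fun x => x ⊑ c ∨ answerable t c ⊑ x) (fun x hx ih => ?_)
    (fun X _ ih => ?_) x hx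
  · rcases ih with h | h
    · by_cases e : x = c
      · exact Or.inr (e ▸ fun z hz => hz)
      · exact Or.inl (hc x hx h e)
    · exact Or.inr fun z hz => IsStage.subset_answerable x hx z (h z hz)
  · by_cases h : ∀ x, x ε X → x ⊑ c
    · refine Or.inl fun z hz => ?_
      obtain ⟨x, hx, hz⟩ := mem_sUnion.1 hz
      exact h x hx z hz
    · push Not at h
      obtain ⟨x, hx, hxc⟩ := h
      exact Or.inr fun z hz => mem_sUnion.2 ⟨x, hx, (ih x hx).resolve_left hxc z hz⟩

/-- The proviso of `stage_dichotomy` holds for all stages. -/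
theorem answerable_subset_of_ne (c : M) (hc : IsStage t c) :
    ∀ x, IsStage t x → x ⊑ c → x ≠ c → answerable t x ⊑ c := by
  refine stage_induction (P := fun c => ∀ x, IsStage t x → x ⊑ c → x ≠ c → answerable t x ⊑ c)
    (fun c _ ih x hx hxc hne => ?_) (fun C hC ih x hx hxC hne => ?_) c hc
  · rcases stage_dichotomy ih x hx with h | h
    · exact answerable_mono h
    · exact (hne (subset_antisymm hxc h)).elim
  · have hle : ∀ c, c ε C → c ⊑ sUnion C := fun c hc z hz => mem_sUnion.2 ⟨c, hc, hz⟩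
    by_cases h : ∃ c, c ε C ∧ x ⊑ c
    · obtain ⟨c, hcC, hxc⟩ := h
      by_cases e : x = c
      · subst e
        rcases stage_dichotomy (ih x hcC) _ (IsStage.sUnion hC) with h | h
        · exact (hne (subset_antisymm hxC h)).elim
        · exact h
      · exact fun z hz => hle c hcC z (ih c hcC x hx hxc e z hz)
    · refine (hne (subset_antisymm hxC fun z hz => ?_)).elim
      obtain ⟨c, hcC, hz⟩ := mem_sUnion.1 hz
      have := (stage_dichotomy (ih c hcC) x hx).resolve_left fun h' => h ⟨c, hcC, h'⟩
      exact this z (IsStage.subset_answerable c (hC c hcC) z hz)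

theorem IsStage.subset_or {s s' : M} (hs : IsStage t s) (hs' : IsStage t s') :
    s' ⊑ s ∨ SetGame.answerable t s ⊑ s' :=
  stage_dichotomy (answerable_subset_of_ne s hs) s' hs'

/-- The positions in `t` that are lost for the player to move: the union of all stages, which is
the least fixed point of `answerable t`. -/
noncomputable def lost (t : M) : M := sUnion (sep (power t) (IsStage t))

theorem mem_lost {y : M} : y ε lost t ↔ ∃ s, IsStage t s ∧ y ε s := by
  rw [lost, mem_sUnion]
  refine exists_congr fun s => and_congr_left fun _ => ?_
  exact mem_sep.trans ⟨fun h => h.2, fun h => ⟨mem_power.2 h.subset, h⟩⟩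

theorem isStage_lost (t : M) : IsStage t (lost t) := IsStage.sUnion fun _ hs => (mem_sep.1 hs).2

theorem lost_subset_of_answerable_subset {s : M} (h : answerable t s ⊑ s) : lost t ⊑ s := by
  refine stage_induction (P := fun r => r ⊑ s) (fun r _ hr z hz => h z (answerable_mono hr z hz))
    (fun X _ hX z hz => ?_) _ (isStage_lost t)
  obtain ⟨r, hr, hz⟩ := mem_sUnion.1 hz
  exact hX r hr z hz

theorem mem_lost_iff {y : M} :
    y ε lost t ↔ y ε t ∧ ∀ z, z ε y → ∃ w, w ε z ∧ w ε lost t := by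
  rw [← mem_answerable]
  exact ⟨IsStage.subset_answerable _ (isStage_lost t) y,
    fun h => mem_lost.2 ⟨_, (isStage_lost t).answerable, h⟩⟩

/-- No position is both lost and won for the player to move. -/
theorem not_mem_lost_of_mem_lost {y z : M} (hy : y ε lost t) (hz : z ε y) : ¬ z ε lost t := by
  have h : lost t ⊑ sep (lost t) fun y => ∀ z, z ε y → ¬ z ε lost t := by
    refine lost_subset_of_answerable_subset fun y hy => ?_
    obtain ⟨hyt, hy⟩ := mem_answerable.1 hy
    refine mem_sep.2 ⟨mem_lost_iff.2 ⟨hyt, fun z hz => ?_⟩, fun z hz hzl => ?_⟩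
    · obtain ⟨w, hw, hw'⟩ := hy z hz
      exact ⟨w, hw, (mem_sep.1 hw').1⟩
    · obtain ⟨w, hw, hw'⟩ := hy z hz
      obtain ⟨x, hx, hxl⟩ := (mem_lost_iff.1 hzl).2 w hw
      exact (mem_sep.1 hw').2 x hx hxl
  exact (mem_sep.1 (h y hy)).2 z hz

/-- A nonempty set of lost positions is met for the first time right after some stage. -/
theorem exists_isStage_first {X : M} (hX : X ⊑ lost t) (hne : ∃ x, x ε X) :
    ∃ s, IsStage t s ∧ (∀ x, x ε X → ¬ x ε s) ∧ ∃ x, x ε X ∧ x ε answerable t s := by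
  set S := sep (power t) fun s => IsStage t s ∧ ∀ x, x ε X → ¬ x ε s
  have hmem : ∀ s, s ε S ↔ IsStage t s ∧ ∀ x, x ε X → ¬ x ε s := fun s =>
    mem_sep.trans ⟨fun h => h.2, fun h => ⟨mem_power.2 h.1.subset, h⟩⟩
  have hst : IsStage t (sUnion S) := IsStage.sUnion fun s hs => ((hmem s).1 hs).1
  have hdis : ∀ x, x ε X → ¬ x ε sUnion S := by
    intro x hx hxS
    obtain ⟨s, hs, hxs⟩ := mem_sUnion.1 hxS
    exact ((hmem s).1 hs).2 x hx hxs
  refine ⟨sUnion S, hst, hdis, ?_⟩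
  by_contra! h
  obtain ⟨x, hx⟩ := hne
  refine hdis x hx (lost_subset_of_answerable_subset (fun z hz => ?_) x (hX x hx))
  exact mem_sUnion.2 ⟨_, (hmem _).2 ⟨hst.answerable, h⟩, hz⟩

/-- `w` enters the stages no later than `w'`, that is, the rank of `w` is at most that of `w'`. -/
def NoLater (t w w' : M) : Prop := ∀ s, IsStage t s → w' ε s → w ε s

theorem exists_noLater {X : M} (hX : X ⊑ lost t) (hne : ∃ x, x ε X) :
    ∃ w, w ε X ∧ ∀ w', w' ε X → NoLater t w w' := by
  obtain ⟨s, hs, hdis, w, hw, hws⟩ := exists_isStage_first hX hne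
  refine ⟨w, hw, fun w' hw' s' hs' hw's' => ?_⟩
  rcases hs.subset_or hs' with h | h
  · exact (hdis w' hw' (h w' hw's')).elim
  · exact h w hws

theorem exists_isStage_of_mem_lost {y : M} (hy : y ε lost t) :
    ∃ s, IsStage t s ∧ ¬ y ε s ∧ y ε answerable t s := by
  obtain ⟨s, hs, h, x, hx, hxs⟩ := exists_isStage_first (t := t) (X := upair y y)
    (fun z hz => by
      rcases mem_upair.1 hz with rfl | rfl <;> exact hy) ⟨y, mem_upair.2 (Or.inl rfl)⟩
  obtain rfl : x = y := by simpa [mem_upair] using hx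
  exact ⟨s, hs, h x hx, hxs⟩

/-! ### Winning strategies -/

theorem move_iff {p q : M} : Move ZFMinusModel.E p q ↔
    ∃ y h z, p = pair y h ∧ z ε y ∧ q = pair z p := by
  simp only [Move, isPair_iff]

theorem isStart_iff {r x : M} : IsStart ZFMinusModel.E r x ↔ r = pair x (emp M) := by
  simp only [IsStart, isPair_iff, isEmptySet_iff]
  exact ⟨by rintro ⟨_, rfl, h⟩; exact h, fun h => ⟨_, rfl, h⟩⟩

theorem pair_ne_emp (a b : M) : pair a b ≠ emp M := fun h =>
  not_mem_emp (h ▸ mem_upair.2 (Or.inl rfl) : upair a a ε emp M)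

/-- There is a set of histories that contains the start of the game on each `y ∈ t` and is closed
under appending elements of `t`. -/
theorem exists_histories (t : M) : ∃ H : M, (∀ y, y ε t → pair y (emp M) ε H) ∧
    ∀ p z, p ε H → z ε t → pair z p ε H := by
  obtain ⟨S, h₀, hS⟩ := exists_closed_set (fun h => prod t h) (prod t (upair (emp M) (emp M)))
  refine ⟨sUnion S, fun y hy => mem_sUnion.2 ⟨_, h₀, mem_prod.2
    ⟨y, _, hy, mem_upair.2 (Or.inl rfl), rfl⟩⟩, fun p z hp hz => ?_⟩
  obtain ⟨s, hs, hps⟩ := mem_sUnion.1 hp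
  exact mem_sUnion.2 ⟨_, hS s hs, mem_prod.2 ⟨z, p, hz, hps, rfl⟩⟩

/-- The owner always moves to lost positions of least rank. This single strategy wins from every
position that is lost for the adversary to move, or from which such a position can be reached. -/
theorem exists_isWinningStrategy (ht : IsTransSet ZFMinusModel.E t) :
    ∃ A B, IsWinningStrategy ZFMinusModel.E A B ∧
      (∀ y, y ε lost t → pair y (emp M) ε B) ∧
      (∀ y, y ε t → (∃ w, w ε y ∧ w ε lost t) → pair y (emp M) ε A) := by
  obtain ⟨H, hH₀, hH⟩ := exists_histories t
  have hlt : lost t ⊑ t := (isStage_lost t).subset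
  have hA : ∃ A, ∀ p, p ε A ↔
      p ε H ∧ ∃ z h, p = pair z h ∧ z ε t ∧ ∃ w, w ε z ∧ w ε lost t := exists_sep _ _
  have hB : ∃ B, ∀ p, p ε B ↔ p ε H ∧ ∃ w h, p = pair w h ∧ w ε lost t ∧ ∀ z h', h = pair z h' →
      ∀ w', w' ε z → w' ε lost t → NoLater t w w' := by
    unfold NoLater
    exact exists_sep _ _
  obtain ⟨A, hA⟩ := hA
  obtain ⟨B, hB⟩ := hB
  have hdisj : ∀ p, p ε A → ¬ p ε B := by
    intro p hpA hpB
    obtain ⟨-, z, h, rfl, -, w, hw, hwl⟩ := (hA _).1 hpA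
    obtain ⟨-, w', h', e, hw', -⟩ := (hB _).1 hpB
    obtain ⟨rfl, -⟩ := pair_inj.1 e
    exact not_mem_lost_of_mem_lost hw' hw hwl
  refine ⟨A, B, ⟨fun p hp => ?_, fun p hp q hq => ?_, fun U hU hne => ?_⟩, fun y hy => ?_,
    fun y hyt hy => ?_⟩
  · obtain ⟨hpH, z, h, rfl, -, w₀, hw₀, hw₀l⟩ := (hA p).1 hp
    obtain ⟨w, hw, hmin⟩ := exists_noLater (t := t) (X := sep (lost t) fun w => w ε z)
      (fun w hw => (mem_sep.1 hw).1) ⟨w₀, mem_sep.2 ⟨hw₀l, hw₀⟩⟩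
    obtain ⟨hwl, hwz⟩ := mem_sep.1 hw
    refine ⟨pair w (pair z h), move_iff.2 ⟨z, h, w, rfl, hwz, rfl⟩, (hB _).2
      ⟨hH _ w hpH (hlt w hwl), w, pair z h, rfl, hwl, fun z' h' e w' hw' hw'l => ?_⟩⟩
    obtain ⟨rfl, -⟩ := pair_inj.1 e
    exact hmin w' (mem_sep.2 ⟨hw'l, hw'⟩)
  · obtain ⟨hpH, w, h, rfl, hwl, -⟩ := (hB p).1 hp
    obtain ⟨y, h', z, e, hz, rfl⟩ := move_iff.1 hq
    obtain ⟨rfl, rfl⟩ := pair_inj.1 e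
    have hzt : z ε t := ht w (hlt w hwl) z hz
    exact (hA _).2 ⟨hH _ z hpH hzt, z, _, rfl, hzt, (mem_lost_iff.1 hwl).2 z hz⟩
  · -- A set `U` without a terminal play would contain a play at a lost position of least rank, with
    -- the adversary to move; two moves later the owner has reached a smaller rank.
    by_contra! hcon
    have hstep : ∀ p, p ε U → p ε B → ∃ z, (∃ y h, p = pair y h ∧ z ε y) ∧ ∃ w, w ε z ∧
        pair w (pair z p) ε U ∧ pair w (pair z p) ε B := by
      intro p hpU hpB
      obtain ⟨q, hqU, hpq, hq⟩ := hcon p hpU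
      have hqA : q ε A := (hq.resolve_left fun h => hdisj p h.1 hpB).2
      obtain ⟨y, h, z, rfl, hz, rfl⟩ := move_iff.1 hpq
      obtain ⟨r, hrU, hqr, hr⟩ := hcon _ hqU
      have hrB : r ε B := (hr.resolve_right fun h => hdisj _ hqA h.1).2
      obtain ⟨z', h', w, e, hw, rfl⟩ := move_iff.1 hqr
      obtain ⟨rfl, -⟩ := pair_inj.1 e
      exact ⟨z, ⟨y, h, rfl, hz⟩, w, hw, hrU, hrB⟩
    have hex : ∃ p, p ε U ∧ p ε B := by
      obtain ⟨p, hpU⟩ := hne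
      obtain ⟨q, hqU, -, hq⟩ := hcon p hpU
      rcases hq with hq | hq
      · exact ⟨q, hqU, hq.2⟩
      · exact ⟨p, hpU, hq.1⟩
    obtain ⟨y, hy, hmin⟩ := exists_noLater (t := t)
      (X := sep (lost t) fun y => ∃ h, pair y h ε U ∧ pair y h ε B)
      (fun w hw => (mem_sep.1 hw).1) (by
        obtain ⟨p, hpU, hpB⟩ := hex
        obtain ⟨-, w, h, rfl, hwl, -⟩ := (hB p).1 hpB
        exact ⟨w, mem_sep.2 ⟨hwl, h, hpU, hpB⟩⟩)
    obtain ⟨hyl, h, hyU, hyB⟩ := mem_sep.1 hy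
    obtain ⟨z, ⟨y', h', e, hz⟩, w, hw, hwU, hwB⟩ := hstep _ hyU hyB
    obtain ⟨rfl, rfl⟩ := pair_inj.1 e
    obtain ⟨s, hs, hys, hy'⟩ := exists_isStage_of_mem_lost hyl
    obtain ⟨w', hw', hw's⟩ := (mem_answerable.1 hy').2 z hz
    obtain ⟨-, w₁, h₁, e₁, hwl, hwmin⟩ := (hB _).1 hwB
    obtain ⟨rfl, rfl⟩ := pair_inj.1 e₁
    have hws : w ε s := hwmin z _ rfl w' hw' (mem_lost.2 ⟨s, hs, hw's⟩) s hs hw's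
    exact hys (hmin w (mem_sep.2 ⟨hwl, _, hwU, hwB⟩) s hs hws)
  · exact (hB _).2 ⟨hH₀ y (hlt y hy), y, emp M, rfl, hy, fun z h' e =>
      (pair_ne_emp z h' e.symm).elim⟩
  · exact (hA _).2 ⟨hH₀ y hyt, y, emp M, rfl, hyt, hy⟩

/-- A winning strategy visits only positions of the expected kind: the plays according to the
strategy that are at other positions form a set without a terminal play. -/
theorem IsWinningStrategy.mem_lost (ht : IsTransSet ZFMinusModel.E t) {A B : M}
    (hAB : IsWinningStrategy ZFMinusModel.E A B) :
    (∀ y h, y ε t → pair y h ε B → y ε lost t) ∧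
      ∀ y h, y ε t → pair y h ε A → ∃ w, w ε y ∧ w ε lost t := by
  set U := sep (sUnion (upair A B)) fun p => ∃ y h, p = pair y h ∧ y ε t ∧
    ((p ε B ∧ ¬ y ε lost t) ∨ (p ε A ∧ ∀ w, w ε y → ¬ w ε lost t))
  have hU : ∀ p, p ε U ↔ ∃ y h, p = pair y h ∧ y ε t ∧
      ((p ε B ∧ ¬ y ε lost t) ∨ (p ε A ∧ ∀ w, w ε y → ¬ w ε lost t)) := by
    refine fun p => mem_sep.trans ⟨fun h => h.2, fun h => ⟨?_, h⟩⟩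
    obtain ⟨y, h, -, -, h' | h'⟩ := h
    · exact mem_sUnion.2 ⟨B, mem_upair.2 (Or.inr rfl), h'.1⟩
    · exact mem_sUnion.2 ⟨A, mem_upair.2 (Or.inl rfl), h'.1⟩
  have hempty : ∀ p, ¬ p ε U := by
    intro p₀ hp₀
    obtain ⟨p, hp, hterm⟩ := hAB.terminates U (fun p hp => by
      obtain ⟨y, h, -, -, h' | h'⟩ := (hU p).1 hp
      · exact Or.inr h'.1
      · exact Or.inl h'.1) ⟨p₀, hp₀⟩
    obtain ⟨y, h, rfl, hyt, ⟨hpB, hy⟩ | ⟨hpA, hy⟩⟩ := (hU p).1 hp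
    · rw [mem_lost_iff] at hy
      push Not at hy
      obtain ⟨z, hz, hzw⟩ := hy hyt
      have hm : Move ZFMinusModel.E (pair y h) (pair z (pair y h)) :=
        move_iff.2 ⟨y, h, z, rfl, hz, rfl⟩
      have hA := hAB.reply _ hpB _ hm
      exact hterm _ ((hU _).2 ⟨z, _, rfl, ht y hyt z hz, Or.inr ⟨hA, hzw⟩⟩) hm (Or.inr ⟨hpB, hA⟩)
    · obtain ⟨q, hm, hqB⟩ := hAB.move _ hpA
      obtain ⟨y', h', w, e, hw, rfl⟩ := move_iff.1 hm
      obtain ⟨rfl, rfl⟩ := pair_inj.1 e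
      exact hterm _ ((hU _).2 ⟨w, _, rfl, ht y hyt w hw, Or.inl ⟨hqB, hy w hw⟩⟩) hm
        (Or.inl ⟨hpA, hqB⟩)
  refine ⟨fun y h hy hB => ?_, fun y h hy hA => ?_⟩
  · by_contra hl
    exact hempty _ ((hU _).2 ⟨y, h, rfl, hy, Or.inl ⟨hB, hl⟩⟩)
  · by_contra! hl
    exact hempty _ ((hU _).2 ⟨y, h, rfl, hy, Or.inr ⟨hA, hl⟩⟩)

theorem winningII_iff (ht : IsTransSet ZFMinusModel.E t) {y : M} (hy : y ε t) :
    WinningII ZFMinusModel.E y ↔ y ε lost t := by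
  constructor
  · rintro ⟨A, B, r, hAB, hr, hrB⟩
    exact (hAB.mem_lost ht).1 y _ hy (isStart_iff.1 hr ▸ hrB)
  · intro h
    obtain ⟨A, B, hAB, hB, -⟩ := exists_isWinningStrategy ht
    exact ⟨A, B, _, hAB, isStart_iff.2 rfl, hB y h⟩

theorem winningI_iff (ht : IsTransSet ZFMinusModel.E t) {y : M} (hy : y ε t) :
    WinningI ZFMinusModel.E y ↔ ∃ w, w ε y ∧ w ε lost t := by
  constructor
  · rintro ⟨A, B, r, hAB, hr, hrA⟩
    exact (hAB.mem_lost ht).2 y _ hy (isStart_iff.1 hr ▸ hrA)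
  · intro h
    obtain ⟨A, B, hAB, -, hA⟩ := exists_isWinningStrategy ht
    exact ⟨A, B, _, hAB, isStart_iff.2 rfl, hA y hy h⟩

/-- A set of winning sets is winning: I wins if he can move to a set on which II wins; otherwise I
wins on every element, and so II wins. -/
theorem mem_W_of_forall_mem {x : M} (hx : ∀ y, y ε x → y ∈ W ZFMinusModel.E) :
    x ∈ W ZFMinusModel.E := by
  obtain ⟨t, ht, hxt⟩ := exists_isTransSet (upair x x)
  have hxt : x ε t := hxt x (mem_upair.2 (Or.inl rfl))
  by_cases h : ∃ w, w ε x ∧ w ε lost t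
  · exact Or.inl ((winningI_iff ht hxt).2 h)
  · refine Or.inr ((winningII_iff ht hxt).2 (mem_lost_iff.2 ⟨hxt, fun z hz => ?_⟩))
    have hzt := ht x hxt z hz
    rcases hx z hz with hI | hII
    · exact (winningI_iff ht hzt).1 hI
    · exact (h ⟨z, hz, (winningII_iff ht hzt).1 hII⟩).elim

/-! ### Hereditarily winning sets -/

instance Dfn.isWinningStrategy (A B : (ℕ → M) → M) [DFun A] [DFun B] :
    Dfn fun v => IsWinningStrategy ZFMinusModel.E (A v) (B v) := by
  refine Dfn.comp₂ (P := IsWinningStrategy _) (Dfn.congr (P := fun v =>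
    (∀ p, p ε v 0 → ∃ q, (∃ y h z, p = pair y h ∧ z ε y ∧ q = pair z p) ∧ q ε v 1) ∧
    (∀ p, p ε v 1 → ∀ q, (∃ y h z, p = pair y h ∧ z ε y ∧ q = pair z p) → q ε v 0) ∧
    (∀ U, (∀ p, p ε U → p ε v 0 ∨ p ε v 1) → (∃ p, p ε U) →
      ∃ p, p ε U ∧ ∀ q, q ε U → (∃ y h z, p = pair y h ∧ z ε y ∧ q = pair z p) →
        ¬ ((p ε v 0 ∧ q ε v 1) ∨ (p ε v 1 ∧ q ε v 0)))) inferInstance fun v => ?_) A B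
  simp only [← move_iff]
  exact ⟨fun h => ⟨h.1, h.2.1, h.2.2⟩, fun h => ⟨h.1, h.2, h.3⟩⟩

instance Dfn.mem_W (x : (ℕ → M) → M) [DFun x] :
    Dfn fun v => x v ∈ W ZFMinusModel.E := by
  refine Dfn.comp₁ (P := fun x => WinningI _ x ∨ WinningII _ x) ?_ x
  unfold WinningI WinningII
  simp only [isStart_iff]
  infer_instance

instance Dfn.mem_HW (x : (ℕ → M) → M) [DFun x] :
    Dfn fun v => x v ∈ HW ZFMinusModel.E := by
  refine Dfn.comp₁ (P := fun x => ∃ s t, IsUPair _ s x x ∧ IsTC _ t s ∧ ∀ y, y ε t → y ∈ W _) ?_ x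
  simp only [isUPair_iff]
  infer_instance

theorem mem_HW_iff {x : M} : x ∈ HW ZFMinusModel.E ↔
    ∃ t, IsTC ZFMinusModel.E t (upair x x) ∧
      ∀ y, y ε t → y ∈ W ZFMinusModel.E := by
  constructor
  · rintro ⟨s, t, hs, h⟩
    exact ⟨t, isUPair_iff.1 hs ▸ h⟩
  · rintro ⟨t, h⟩
    exact ⟨_, t, isUPair_upair x x, h⟩

theorem mem_W_of_mem_HW {x : M} (hx : x ∈ HW ZFMinusModel.E) :
    x ∈ W ZFMinusModel.E := by
  obtain ⟨t, ht, h⟩ := mem_HW_iff.1 hx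
  exact h x (ht.2.1 x (mem_upair.2 (Or.inl rfl)))

theorem mem_HW_of_mem {x y : M} (hx : x ∈ HW ZFMinusModel.E) (hy : y ε x) :
    y ∈ HW ZFMinusModel.E := by
  obtain ⟨t, ht, h⟩ := mem_HW_iff.1 hx
  obtain ⟨t', ht'⟩ := exists_isTC (upair y y)
  have hyt : y ε t := ht.1 x (ht.2.1 x (mem_upair.2 (Or.inl rfl))) y hy
  refine mem_HW_iff.2 ⟨t', ht', fun z hz => h z (ht'.2.2 t ht.1 (fun w hw => ?_) z hz)⟩
  rcases mem_upair.1 hw with rfl | rfl <;> exact hyt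

/-- Every set of hereditarily winning sets is hereditarily winning. -/
theorem mem_HW_of_forall_mem {x : M} (hx : ∀ y, y ε x → y ∈ HW ZFMinusModel.E) :
    x ∈ HW ZFMinusModel.E := by
  obtain ⟨t, ht⟩ := exists_isTC (upair x x)
  have hxW := mem_W_of_forall_mem fun y hy => mem_W_of_mem_HW (hx y hy)
  have hsub : t ⊑ sep t fun y => y = x ∨ y ∈ HW ZFMinusModel.E := by
    refine ht.2.2 _ (fun y hy z hz => ?_) fun y hy =>
      mem_sep.2 ⟨ht.2.1 y hy, Or.inl (by simpa [mem_upair] using hy)⟩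
    obtain ⟨hyt, hy⟩ := mem_sep.1 hy
    refine mem_sep.2 ⟨ht.1 y hyt z hz, Or.inr ?_⟩
    rcases hy with rfl | hy
    · exact hx z hz
    · exact mem_HW_of_mem hy hz
  refine mem_HW_iff.2 ⟨t, ht, fun y hy => ?_⟩
  rcases (mem_sep.1 (hsub y hy)).2 with rfl | h
  · exact hxW
  · exact mem_W_of_mem_HW h

/-- An `∈`-minimal element of `t \ HW` would be a set of hereditarily winning sets. -/
theorem mem_HW_of_wellFoundedOn {t : M} (ht : IsTransSet ZFMinusModel.E t)
    (hwf : WellFoundedOn ZFMinusModel.E t) {x : M} (hx : x ε t) :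
    x ∈ HW ZFMinusModel.E := by
  by_contra hxH
  obtain ⟨y, hy, hmin⟩ := hwf (sep t fun y => ¬ y ∈ HW ZFMinusModel.E)
    (fun y hy => (mem_sep.1 hy).1) ⟨x, mem_sep.2 ⟨hx, hxH⟩⟩
  obtain ⟨hyt, hyH⟩ := mem_sep.1 hy
  refine hyH (mem_HW_of_forall_mem fun z hz => ?_)
  by_contra hzH
  exact hmin z (mem_sep.2 ⟨ht y hyt z hz, hzH⟩) hz

theorem VInfty_subset_HW : VInfty (ZFMinusModel.E (M := M)) ⊆ HW (ZFMinusModel.E (M := M)) := by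
  rintro x ⟨s, t, hs, ht, hwf⟩
  exact mem_HW_of_wellFoundedOn ht.1 hwf (ht.2.1 x ((hs x).2 (Or.inl rfl)))

theorem mem_HW_of_isOrdinal {a : M} (ha : IsOrdinal ZFMinusModel.E a) :
    a ∈ HW ZFMinusModel.E :=
  mem_HW_of_forall_mem fun _ hy => mem_HW_of_wellFoundedOn ha.1 ha.2.2.2.2 hy

/-! ### Relativization of formulas -/

/-- The restriction of the membership relation to `C`. -/
def relE (C : Set M) (x y : C) : Prop := x.1 ε y.1

theorem term_eq_var {α : Type*} (t : setLang.Term α) : ∃ a, t = FirstOrder.Language.Term.var a := by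
  cases t with
  | var a => exact ⟨a, rfl⟩
  | func f _ => exact Empty.elim f

/-- The relativization of a formula to a definable class `C` is definable. The variables of the
formula are instantiated by definable functions, so that under a quantifier the context can be
shifted. -/
theorem exists_relativization {C : Set M} (hC : Dfn fun w : ℕ → M => w 0 ∈ C) {α : Type*} {n : ℕ}
    (φ : setLang.BoundedFormula α n) (s : α → (ℕ → M) → M) (hs : ∀ a, DFun (s a))
    (xs : Fin n → (ℕ → M) → M) (hxs : ∀ i, DFun (xs i)) :
    letI := setStructure (relE C)
    ∃ P : (ℕ → M) → Prop, Dfn P ∧ ∀ v (h : ∀ a, s a v ∈ C) (h' : ∀ i, xs i v ∈ C),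
      φ.Realize (fun a => (⟨s a v, h a⟩ : C)) (fun i => ⟨xs i v, h' i⟩) ↔ P v := by
  let := setStructure (relE C)
  have hval : ∀ {n : ℕ} (s : α → (ℕ → M) → M) (xs : Fin n → (ℕ → M) → M) (x : α ⊕ Fin n) v
      (h : ∀ a, s a v ∈ C) (h' : ∀ i, xs i v ∈ C),
      (Sum.elim (fun a => (⟨s a v, h a⟩ : C)) (fun i => ⟨xs i v, h' i⟩) x : C).1 =
        Sum.elim s xs x v := by
    rintro n s xs (x | x) v h h' <;> rfl
  have hfun : ∀ {n : ℕ} (s : α → (ℕ → M) → M) (_ : ∀ a, DFun (s a)) (xs : Fin n → (ℕ → M) → M)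
      (_ : ∀ i, DFun (xs i)) (x : α ⊕ Fin n), DFun (Sum.elim s xs x) := by
    rintro n s hs xs hxs (x | x)
    · exact hs x
    · exact hxs x
  induction φ generalizing s with
  | falsum => exact ⟨fun _ => False, inferInstance, fun v h h' => Iff.rfl⟩
  | equal t₁ t₂ =>
    obtain ⟨a, rfl⟩ := term_eq_var t₁
    obtain ⟨b, rfl⟩ := term_eq_var t₂
    have ha := hfun s hs xs hxs a
    have hb := hfun s hs xs hxs b
    refine ⟨fun v => Sum.elim s xs a v = Sum.elim s xs b v, inferInstance, fun v h h' => ?_⟩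
    beta_reduce
    rw [← hval s xs a v h h', ← hval s xs b v h h']
    exact Subtype.ext_iff
  | rel R ts =>
    cases R
    obtain ⟨a, ha⟩ := term_eq_var (ts 0)
    obtain ⟨b, hb⟩ := term_eq_var (ts 1)
    have ha' := hfun s hs xs hxs a
    have hb' := hfun s hs xs hxs b
    refine ⟨fun v => Sum.elim s xs a v ε Sum.elim s xs b v, inferInstance, fun v h h' => ?_⟩
    beta_reduce
    rw [← hval s xs a v h h', ← hval s xs b v h h']
    change relE C ((ts 0).realize _) ((ts 1).realize _) ↔ _
    rw [ha, hb]
    exact Iff.rfl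
  | imp φ ψ ihφ ihψ =>
    obtain ⟨P, hP, hφ⟩ := ihφ s hs xs hxs
    obtain ⟨Q, hQ, hψ⟩ := ihψ s hs xs hxs
    exact ⟨fun v => P v → Q v, inferInstance, fun v h h' => imp_congr (hφ v h h') (hψ v h h')⟩
  | all φ ih =>
    obtain ⟨P, hP, hφ⟩ := ih (fun a w => s a fun i => w (i + 1)) (fun a => (hs a).rename _)
      (Fin.snoc (α := fun _ => (ℕ → M) → M) (fun j w => xs j fun i => w (i + 1)) fun w => w 0)
      (fun j => by
        refine Fin.lastCases ?_ (fun j => ?_) j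
        · rw [Fin.snoc_last]; infer_instance
        · rw [Fin.snoc_castSucc]; exact (hxs j).rename _)
    let cons (x : M) (v : ℕ → M) : ℕ → M := fun i => Nat.casesOn i x v
    have : Dfn fun w : ℕ → M => P (cons (w 0) fun i => w (i + 1)) :=
      hP.congr fun w => by
        rw [show cons (w 0) (fun i => w (i + 1)) = w by ext i; cases i <;> rfl]
    refine ⟨fun v => ∀ x, x ∈ C → P (cons x v), inferInstance, fun v h h' => ?_⟩
    have hmem : ∀ x ∈ C, ∀ i, (Fin.snoc (α := fun _ => (ℕ → M) → M)
        (fun j w => xs j fun i => w (i + 1)) fun w => w 0) i (cons x v) ∈ C := by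
      intro x hx i
      refine Fin.lastCases ?_ (fun j => ?_) i
      · rw [Fin.snoc_last]; exact hx
      · rw [Fin.snoc_castSucc]; exact h' j
    have hreal : ∀ x (hx : x ∈ C), φ.Realize (fun a => (⟨s a v, h a⟩ : C))
        (Fin.snoc (fun i => (⟨xs i v, h' i⟩ : C)) ⟨x, hx⟩) ↔ P (cons x v) := by
      intro x hx
      rw [← hφ (cons x v) h (hmem x hx)]
      have : (Fin.snoc (fun i => (⟨xs i v, h' i⟩ : C)) ⟨x, hx⟩ : Fin _ → C) =
          fun i => ⟨_, hmem x hx i⟩ := by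
        ext i
        refine Fin.lastCases ?_ (fun j => ?_) i
        · simp [cons]
        · simp [cons]
      rw [this]
    exact ⟨fun H x hx => (hreal x hx).1 (H ⟨x, hx⟩), fun H x => (hreal x.1 x.2).2 (H x.1 x.2)⟩

theorem dfn_of_isClass {C : Set M} (hC : Dfn fun w : ℕ → M => w 0 ∈ C) {D : Set C}
    (hD : IsClass (relE C) D) : Dfn fun w : ℕ → M => ∃ h : w 0 ∈ C, (⟨w 0, h⟩ : C) ∈ D := by
  let := setStructure (relE C)
  obtain ⟨φ, hφ⟩ := Set.definable_iff_exists_formula_sum.1 hD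
  obtain ⟨P, hP, h⟩ := exists_relativization hC φ
    (Sum.elim (fun c _ => c.1.1) fun _ w => w 0)
    (by rintro (a | a) <;> dsimp only [Sum.elim_inl, Sum.elim_inr] <;> infer_instance)
    (fun i => i.elim0) fun i => i.elim0
  refine Dfn.congr (P := fun w => w 0 ∈ C ∧ P w) (Dfn.and _ _) fun w => ?_
  rw [← exists_prop]
  refine exists_congr fun hw => ?_
  have hs : ∀ a, (Sum.elim (fun c _ => c.1.1) fun _ w => w 0 :
      (Set.univ : Set C) ⊕ Fin 1 → (ℕ → M) → M) a w ∈ C := by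
    rintro (a | a)
    · exact a.1.2
    · exact hw
  rw [← h w hs fun i => i.elim0]
  have e := Set.ext_iff.1 hφ fun _ => ⟨w 0, hw⟩
  refine Iff.trans ?_ e.symm
  simp only [Set.mem_ofPred_eq, FirstOrder.Language.Formula.Realize]
  have e₁ : (fun a => (⟨_, hs a⟩ : C)) =
      Sum.elim (fun a : (Set.univ : Set C) => a.1) fun _ => ⟨w 0, hw⟩ := by
    ext a; rcases a with a | a <;> rfl
  rw [e₁, Subsingleton.elim (fun i : Fin 0 => _) (default : Fin 0 → C)]

theorem dfn_of_isClass₂ {C : Set M} (hC : Dfn fun w : ℕ → M => w 0 ∈ C) {D : Set (C × C)}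
    (hD : IsClass₂ (relE C) D) : Dfn fun w : ℕ → M =>
      ∃ (h₀ : w 0 ∈ C) (h₁ : w 1 ∈ C), ((⟨w 0, h₀⟩, ⟨w 1, h₁⟩) : C × C) ∈ D := by
  let := setStructure (relE C)
  obtain ⟨φ, hφ⟩ := Set.definable_iff_exists_formula_sum.1 hD
  obtain ⟨P, hP, h⟩ := exists_relativization hC φ
    (Sum.elim (fun c _ => c.1.1) fun j w => w j)
    (by rintro (a | a) <;> dsimp only [Sum.elim_inl, Sum.elim_inr] <;> infer_instance)
    (fun i => i.elim0) fun i => i.elim0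
  have hC₁ := hC.rename fun _ => 1
  refine Dfn.congr (P := fun w => w 0 ∈ C ∧ w 1 ∈ C ∧ P w) inferInstance fun w => ?_
  rw [← exists_prop]
  refine exists_congr fun h₀ => ?_
  rw [← exists_prop]
  refine exists_congr fun h₁ => ?_
  have hs : ∀ a, (Sum.elim (fun c _ => c.1.1) fun j w => w j :
      (Set.univ : Set C) ⊕ Fin 2 → (ℕ → M) → M) a w ∈ C := by
    rintro (a | a)
    · exact a.1.2
    · fin_cases a
      · exact h₀
      · exact h₁
  rw [← h w hs fun i => i.elim0]
  have e := Set.ext_iff.1 hφ ![⟨w 0, h₀⟩, ⟨w 1, h₁⟩]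
  refine Iff.trans ?_ e.symm
  simp only [Set.mem_ofPred_eq, FirstOrder.Language.Formula.Realize]
  have e₁ : (fun a => (⟨_, hs a⟩ : C)) =
      Sum.elim (fun a : (Set.univ : Set C) => a.1) ![⟨w 0, h₀⟩, ⟨w 1, h₁⟩] := by
    ext a
    rcases a with a | a
    · rfl
    · fin_cases a <;> rfl
  rw [e₁, Subsingleton.elim (fun i : Fin 0 => _) (default : Fin 0 → C)]

/-! ### The axioms in a class that contains all sets of its elements -/

/-- A definable transitive class that contains every set of its elements satisfies the axioms: the
sets that the axioms ask for, formed in the whole model, are already in the class. -/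
theorem isModelZFMinus_of_forall_mem {C : Set M} (hC : Dfn fun w : ℕ → M => w 0 ∈ C)
    (htrans : ∀ x y, x ∈ C → y ε x → y ∈ C) (hclosed : ∀ x, (∀ y, y ε x → y ∈ C) → x ∈ C) :
    IsModelZFMinus (relE C) where
  extensionality a b h := Subtype.ext <| ext_set fun z =>
    ⟨fun hz => (h ⟨z, htrans _ _ a.2 hz⟩).1 hz, fun hz => (h ⟨z, htrans _ _ b.2 hz⟩).2 hz⟩
  pairing a b := ⟨⟨upair a.1 b.1, hclosed _ fun y hy => by
    rcases mem_upair.1 hy with rfl | rfl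
    · exact a.2
    · exact b.2⟩, fun z => mem_upair.trans (or_congr Subtype.ext_iff.symm Subtype.ext_iff.symm)⟩
  union a := ⟨⟨sUnion a.1, hclosed _ fun y hy => by
    obtain ⟨x, hx, hy⟩ := mem_sUnion.1 hy
    exact htrans _ _ (htrans _ _ a.2 hx) hy⟩, fun z => mem_sUnion.trans
      ⟨fun ⟨y, hy, hz⟩ => ⟨⟨y, htrans _ _ a.2 hy⟩, hy, hz⟩, fun ⟨y, hy, hz⟩ => ⟨y.1, hy, hz⟩⟩⟩
  powerSet a := ⟨⟨power a.1, hclosed _ fun y hy => hclosed _ fun z hz =>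
      htrans _ _ a.2 (mem_power.1 hy z hz)⟩, fun z => mem_power.trans
      ⟨fun h w hw => h w.1 hw, fun h w hw => h ⟨w, htrans _ _ z.2 hw⟩ hw⟩⟩
  infinity := by
    have hemp : emp M ∈ C := hclosed _ fun y hy => (not_mem_emp hy).elim
    have hsucc : ∀ n ∈ C, succ n ∈ C := fun n hn => hclosed _ fun y hy => by
      rcases mem_succ.1 hy with h | rfl
      · exact htrans _ _ hn h
      · exact hn
    refine ⟨⟨omega M, hclosed _ (omega_induction (P := fun n => n ∈ C) hemp
      fun n _ hn => hsucc n hn)⟩, ⟨⟨emp M, hemp⟩, fun _ => not_mem_emp, emp_mem_omega⟩,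
      fun x hx => ⟨⟨succ x.1, hsucc _ x.2⟩, fun z => ?_, succ_mem_omega hx⟩⟩
    exact mem_succ.trans (or_congr_right Subtype.ext_iff.symm)
  separation D hD a := by
    have hdef := dfn_of_isClass hC hD
    obtain ⟨b, hb⟩ := exists_sep a.1 fun x => ∃ h : x ∈ C, (⟨x, h⟩ : C) ∈ D
    refine ⟨⟨b, hclosed _ fun y hy => ((hb y).1 hy).2.1⟩, fun z => (hb z.1).trans ?_⟩
    exact and_congr_right fun _ => ⟨fun ⟨_, h⟩ => h, fun h => ⟨z.2, h⟩⟩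
  replacement F hF hfun a := by
    have hdef := dfn_of_isClass₂ hC hF
    obtain ⟨b, hb⟩ := ZFMinusModel.isModel.replacement
      {p : M × M | ∃ (h₀ : p.1 ∈ C) (h₁ : p.2 ∈ C), ((⟨p.1, h₀⟩, ⟨p.2, h₁⟩) : C × C) ∈ F}
      (isClass₂_of_dfn (R := fun x y =>
        ∃ (h₀ : x ∈ C) (h₁ : y ∈ C), ((⟨x, h₀⟩, ⟨y, h₁⟩) : C × C) ∈ F) hdef)
      (fun x y z ⟨h₀, h₁, h⟩ ⟨_, h₂, h'⟩ =>
        congrArg Subtype.val (hfun ⟨x, h₀⟩ ⟨y, h₁⟩ ⟨z, h₂⟩ h h')) a.1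
    refine ⟨⟨b, hclosed _ fun y hy => ?_⟩, fun y => (hb y.1).trans ?_⟩
    · obtain ⟨x, -, -, h, -⟩ := (hb y).1 hy
      exact h
    · exact ⟨fun ⟨x, hx, h₀, _, h⟩ => ⟨⟨x, h₀⟩, hx, h⟩, fun ⟨x, hx, h⟩ => ⟨x.1, hx, x.2, y.2, h⟩⟩

end SetGame

theorem theorem1 {M : Type u} (E : M → M → Prop) (hM : SetGame.IsModelZFMinus E) :
    SetGame.IsInnerModel E (SetGame.HW E) ∧ SetGame.VInfty E ⊆ SetGame.HW E := by
  let : SetGame.ZFMinusModel M := ⟨E, hM⟩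
  have hdef : SetGame.Dfn fun w : ℕ → M => w 0 ∈ SetGame.HW E := SetGame.Dfn.mem_HW fun w => w 0
  exact ⟨{
    isClass := SetGame.isClass_of_dfn hdef
    transitive := fun _ _ => SetGame.mem_HW_of_mem
    ordinals := fun _ => SetGame.mem_HW_of_isOrdinal
    model := SetGame.isModelZFMinus_of_forall_mem hdef (fun _ _ => SetGame.mem_HW_of_mem)
      fun _ => SetGame.mem_HW_of_forall_mem }, SetGame.VInfty_subset_HW⟩
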